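/- Let $E=(E^0,E^1,r,s)$ be an arbitrary directed graph (with vertex set $E^0$, edge set $E^1$ and range and source maps $r,s:E^1\to E^0$) and let $K$ be a field. The Leavitt path algebra $L_K(E)$ is the associative $K$-algebra (in general without unit) generated by a set $\{v\mid v\in E^0\}$ of pairwise orthogonal idempotents together with elements $e,e^*$ for $e\in E^1$, subject to the relations $s(e)e=e\,r(e)=e$, $r(e)e^*=e^*s(e)=e^*$ and $e^*e'=\delta_{e,e'}\,r(e)$ for all $e,e'\in E^1$, and $v=\sum_{s(e)=v}ee^*$ for every vertex $v$ for which $s^{-1}(v)$ is finite and nonempty. A vertex $v$ is called a line point if for every vertex $w$ for which there is a path (possibly of length $0$) from $v$ to $w$, at most one edge has source $w$, and there is no cycle based at $w$, that is, no path $e_1\cdots e_n$ with $n\ge 1$, $s(e_1)=r(e_n)=w$ and $s(e_i)\ne s(e_j)$ for $i\neq j$. Theorem. Let $x\in L_K(E)$ be such that $L_K(E)x=\{ax\mid a\in L_K(E)\}$ is a minimal left ideal, i.e. it is nonzero and the only left ideals of $L_K(E)$ that it contains are $0$ and itself. Then there is a line point $v\in E^0$ such that $L_K(E)x\cong L_K(E)v$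 as left $L_K(E)$-modules. -/

import Mathlib

/-- A directed graph `(E⁰, E¹, r, s)` with vertex set `V`, edge set `A`, source map `src` and
range map `rng`.  Loops and multiple edges are allowed, and there is no restriction on the
number of edges that a vertex emits or receives. -/
structure DirGraph (V : Type*) (A : Type*) where
  src : A → V
  rng : A → V

namespace DirGraph

variable {V : Type*} {A : Type*} (E : DirGraph V A)

/-- `E.IsPath v μ w`: the sequence of edges `μ` is a path of `E` with source `v` and range `w`.
The empty sequence is the path of length zero at `v`, for every vertex `v`. -/
inductive IsPath : V → List A → V → Prop
  | nil (v : V) : IsPath v [] v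
  | cons (e : A) (μ : List A) (w : V) (h : IsPath (E.rng e) μ w) : IsPath (E.src e) (e :: μ) w

/-- The tree `T(v)`: all vertices `w` such that there is a path from `v` to `w`. -/
def tree (v : V) : Set V := {w | ∃ μ : List A, E.IsPath v μ w}

/-- There is a bifurcation at `v`: at least two edges have source `v`. -/
def IsBifurcation (v : V) : Prop := (E.src ⁻¹' {v}).Nontrivial

/-- `μ = e₁ ⋯ eₙ` with `n ≥ 1` is a cycle based at `v`: a closed path based at `v` such that
`s(eᵢ) ≠ s(eⱼ)` for `i ≠ j`. -/
def IsCycleAt (v : V) (μ : List A) : Prop :=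
  μ ≠ [] ∧ E.IsPath v μ v ∧ (μ.map E.src).Nodup

/-- A line point: there are neither bifurcations nor cycles at any vertex of the tree of `u`. -/
def IsLinePoint (u : V) : Prop :=
  ∀ w ∈ E.tree u, ¬ E.IsBifurcation w ∧ ¬ ∃ μ : List A, E.IsCycleAt w μ

end DirGraph

/-! ### The Leavitt path algebra -/

/-- The generators of the Leavitt path algebra: vertices, edges `e`, and ghost edges `e^*`. -/
inductive LeavittGen (V : Type*) (A : Type*)
  | vertex (v : V)
  | edge (e : A)
  | ghost (e : A)

/-- The free associative `K`-algebra, without a unit, on vertices, edges and ghost edges: the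
semigroup algebra of the free semigroup of nonempty words. -/
abbrev LeavittFree (K : Type*) [Field K] (V : Type*) (A : Type*) :=
  MonoidAlgebra K (FreeSemigroup (LeavittGen V A))

namespace LeavittFree

variable (K : Type*) [Field K] {V : Type*} {A : Type*}

/-- A generator, as an element of the free algebra. -/
noncomputable def gen (g : LeavittGen V A) : LeavittFree K V A :=
  MonoidAlgebra.single (FreeSemigroup.of g) 1

/-- The vertex `v` in the free algebra. -/
noncomputable abbrev vertex (v : V) : LeavittFree K V A := gen K (.vertex v)

/-- The edge `e` in the free algebra. -/
noncomputable abbrev edge (e : A) : LeavittFree K V A := gen K (.edge e)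

/-- The ghost edge `e^*` in the free algebra. -/
noncomputable abbrev ghost (e : A) : LeavittFree K V A := gen K (.ghost e)

end LeavittFree

open LeavittFree in
/-- The defining relations of the Leavitt path algebra, closed under multiplication by scalars
(the ring congruence that they generate is then the one of the algebra ideal that they generate;
in a free algebra without unit, closing under scalars is not automatic). -/
inductive LeavittRel (K : Type*) [Field K] {V : Type*} {A : Type*} (E : DirGraph V A) :
    LeavittFree K V A → LeavittFree K V A → Prop
  | idem (v : V) : LeavittRel K E (vertex K v * vertex K v) (vertex K v)
  | orth (v w : V) (h : v ≠ w) : LeavittRel K E (vertex K v * vertex K w) 0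
  | src_edge (e : A) : LeavittRel K E (vertex K (E.src e) * edge K e) (edge K e)
  | edge_rng (e : A) : LeavittRel K E (edge K e * vertex K (E.rng e)) (edge K e)
  | rng_ghost (e : A) : LeavittRel K E (vertex K (E.rng e) * ghost K e) (ghost K e)
  | ghost_src (e : A) : LeavittRel K E (ghost K e * vertex K (E.src e)) (ghost K e)
  | ghost_edge_self (e : A) : LeavittRel K E (ghost K e * edge K e) (vertex K (E.rng e))
  | ghost_edge_ne (e f : A) (h : e ≠ f) : LeavittRel K E (ghost K e * edge K f) 0
  | regular (v : V) (hfin : (E.src ⁻¹' {v}).Finite) (hne : (E.src ⁻¹' {v}).Nonempty) :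
      LeavittRel K E (vertex K v) (∑ e ∈ hfin.toFinset, edge K e * ghost K e)
  | smul (k : K) (x y : LeavittFree K V A) (h : LeavittRel K E x y) :
      LeavittRel K E (k • x) (k • y)

/-- The congruence generated by the defining relations. -/
noncomputable def leavittCon (K : Type*) [Field K] {V : Type*} {A : Type*} (E : DirGraph V A) :
    RingCon (LeavittFree K V A) :=
  ringConGen (LeavittRel K E)

/-- The Leavitt path algebra `L_K(E)`: the quotient of the free associative algebra (without unit)
on vertices, edges and ghost edges by the defining relations. -/
def LeavittPathAlgebra (K : Type*) [Field K] {V : Type*} {A : Type*} (E : DirGraph V A) :=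
  (leavittCon K E).Quotient

namespace LeavittPathAlgebra

variable (K : Type*) [Field K] {V : Type*} {A : Type*} (E : DirGraph V A)

noncomputable instance : NonUnitalRing (LeavittPathAlgebra K E) :=
  inferInstanceAs (NonUnitalRing (leavittCon K E).Quotient)

/-- The quotient map from the free algebra. -/
noncomputable def mk : LeavittFree K V A →ₙ+* LeavittPathAlgebra K E where
  toFun x := (x : (leavittCon K E).Quotient)
  map_mul' _ _ := rfl
  map_zero' := rfl
  map_add' _ _ := rfl

theorem mk_surjective : Function.Surjective (mk K E) := Quotient.mk_surjective

theorem leavittCon_smul (k : K) {x y : LeavittFree K V A} (h : leavittCon K E x y) :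
    leavittCon K E (k • x) (k • y) := by
  change RingConGen.Rel (LeavittRel K E) x y at h
  change RingConGen.Rel (LeavittRel K E) (k • x) (k • y)
  induction h with
  | of x y h => exact .of _ _ (.smul k x y h)
  | refl x => exact .refl _
  | symm _ ih => exact .symm ih
  | trans _ _ ih₁ ih₂ => exact .trans ih₁ ih₂
  | add _ _ ih₁ ih₂ => rw [smul_add, smul_add]; exact .add ih₁ ih₂
  | mul _ h₂ ih₁ _ => rw [← smul_mul_assoc, ← smul_mul_assoc]; exact .mul ih₁ h₂

noncomputable instance : SMul K (LeavittPathAlgebra K E) where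
  smul k := Quotient.map' (k • ·) fun _ _ h => leavittCon_smul K E k h

noncomputable instance : Module K (LeavittPathAlgebra K E) :=
  Function.Surjective.module K (mk K E : LeavittFree K V A →+ LeavittPathAlgebra K E)
    (mk_surjective K E) fun _ _ => rfl

instance : IsScalarTower K (LeavittPathAlgebra K E) (LeavittPathAlgebra K E) where
  smul_assoc k x y := by
    obtain ⟨x, rfl⟩ := mk_surjective K E x
    obtain ⟨y, rfl⟩ := mk_surjective K E y
    exact congrArg (mk K E) (smul_mul_assoc k x y)

instance : SMulCommClass K (LeavittPathAlgebra K E) (LeavittPathAlgebra K E) where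
  smul_comm k x y := by
    obtain ⟨x, rfl⟩ := mk_surjective K E x
    obtain ⟨y, rfl⟩ := mk_surjective K E y
    exact congrArg (mk K E) (mul_smul_comm k x y).symm

/-- The vertex `v` as an element of `L_K(E)`. -/
noncomputable def vertex (v : V) : LeavittPathAlgebra K E := mk K E (LeavittFree.vertex K v)

end LeavittPathAlgebra

/-! ### Left ideals of a ring without unit -/

section LeftIdeals

variable {R : Type*} [NonUnitalRing R]

/-- A left ideal of `R`: an additive subgroup `I` with `R I ⊆ I`. -/
def IsLeftIdeal (I : AddSubgroup R) : Prop := ∀ (a x : R), x ∈ I → a * x ∈ I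

/-- A minimal left ideal: a nonzero left ideal `I` such that the only left ideals contained in `I`
are `0` and `I`. -/
def IsMinimalLeftIdeal (I : AddSubgroup R) : Prop :=
  IsLeftIdeal I ∧ I ≠ ⊥ ∧ ∀ J : AddSubgroup R, IsLeftIdeal J → J ≤ I → J = ⊥ ∨ J = I

/-- The left ideal `R x = {a x ∣ a ∈ R}`. -/
def leftMultiples (x : R) : AddSubgroup R := (AddMonoidHom.mulRight x).range

theorem mem_leftMultiples {x y : R} : y ∈ leftMultiples x ↔ ∃ a : R, a * x = y := Iff.rfl

theorem isLeftIdeal_leftMultiples (x : R) : IsLeftIdeal (leftMultiples x) := by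
  rintro a _ ⟨b, rfl⟩
  exact ⟨a * b, mul_assoc a b x⟩

/-- The left ideals `I` and `J` are isomorphic as left `R`-modules: there is an additive bijection
`f : I → J` with `f (a y) = a f(y)` for all `a ∈ R` and `y ∈ I`. -/
def LeftIdealIso (I J : AddSubgroup R) (hI : IsLeftIdeal I) : Prop :=
  ∃ f : I ≃+ J, ∀ (a : R) (y : I), (f ⟨a * y, hI a y y.2⟩ : R) = a * (f y : R)

end LeftIdeals

/-! Write `L` for the algebra. Every nonzero `x` has a two-sided multiple `a x b` that is either a
vertex or a loop form: a nonzero multiple of a vertex `v` plus closed paths of positive length at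
`v`, all commuting with one closed path `γ` (`isReducible_of_ne_zero`). If `L x` is minimal, right
multiplication by `b` is injective on it and left multiplication by `a` does not change the ideal
generated, so `L x ≅ L a x b` is again minimal (`leftIdealIso_of_mul_mul_ne_zero`).

A loop form `z` never generates a minimal left ideal (`IsLoopForm.not_isMinimalLeftIdeal`). Let `L`
act on Laurent-polynomial-valued functions on infinite paths, each edge contributing a factor `T`.
On the delta function at `γ γ γ ⋯`, `z` acts as a nonzero scalar `q` and `y = v - γ` as `1 - T ^ n`.
Since `z y = y z` is a nonzero element of `L z`, minimality gives `z = a z y`, which makes `1 - T ^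
n` a unit; it vanishes at `T = 1`.

So `a x b` is a vertex `v`. Minimality of `L v` passes to every vertex of the tree of `v`, and it
excludes closed paths, because a vertex on one is a loop form, and bifurcations, because `e e^*`
would generate a proper nonzero left ideal (`isLinePoint_of_isMinimalLeftIdeal`).

For the reduction, multiplying by edges on the right removes ghost edges until a combination of
paths with common range remains. The ghost of a shortest path turns this into a vertex plus closed
paths, and conjugation by paths discards closed paths until the survivors commute with one of them.
-/

open scoped LaurentPolynomial

/-! ### Concatenation of finite paths. -/

namespace DirGraph

variable {V : Type*} {A : Type*} {E : DirGraph V A}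

theorem isPath_cons_iff {v w : V} {e : A} {μ : List A} :
    E.IsPath v (e :: μ) w ↔ v = E.src e ∧ E.IsPath (E.rng e) μ w := by
  constructor
  · rintro ⟨⟩
    exact ⟨rfl, by assumption⟩
  · rintro ⟨rfl, h⟩
    exact .cons _ _ _ h

theorem isPath_nil_iff {v w : V} : E.IsPath v [] w ↔ v = w := by
  constructor
  · rintro ⟨⟩
    rfl
  · rintro rfl
    exact .nil _

theorem IsPath.append {u v w : V} {μ ν : List A} (h : E.IsPath u μ v) (h' : E.IsPath v ν w) :
    E.IsPath u (μ ++ ν) w := by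
  induction h with
  | nil => exact h'
  | cons e μ w _ ih => exact .cons _ _ _ (ih h')

theorem IsPath.of_append {u v w : V} {μ ν : List A} (h : E.IsPath u μ v)
    (h' : E.IsPath u (μ ++ ν) w) : E.IsPath v ν w := by
  induction h with
  | nil => exact h'
  | cons e μ w _ ih => exact ih (isPath_cons_iff.1 h').2

end DirGraph

/-! ### Relations and local units in the Leavitt path algebra. -/

namespace LeavittPathAlgebra

section Basic

variable (K : Type*) [Field K] {V : Type*} {A : Type*} (E : DirGraph V A)

/-- The edge `e` as an element of `L_K(E)`. -/
noncomputable def edge (e : A) : LeavittPathAlgebra K E := mk K E (LeavittFree.edge K e)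

/-- The ghost edge `e^*` as an element of `L_K(E)`. -/
noncomputable def ghost (e : A) : LeavittPathAlgebra K E := mk K E (LeavittFree.ghost K e)

theorem mk_eq_mk {x y : LeavittFree K V A} (h : LeavittRel K E x y) : mk K E x = mk K E y :=
  Quotient.sound (RingConGen.Rel.of x y h)

@[simp]
theorem vertex_mul_self (v : V) : vertex K E v * vertex K E v = vertex K E v :=
  mk_eq_mk K E (.idem v)

theorem vertex_mul_vertex_of_ne {v w : V} (h : v ≠ w) : vertex K E v * vertex K E w = 0 :=
  mk_eq_mk K E (.orth v w h)

@[simp]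
theorem vertex_src_mul_edge (e : A) : vertex K E (E.src e) * edge K E e = edge K E e :=
  mk_eq_mk K E (.src_edge e)

@[simp]
theorem edge_mul_vertex_rng (e : A) : edge K E e * vertex K E (E.rng e) = edge K E e :=
  mk_eq_mk K E (.edge_rng e)

@[simp]
theorem vertex_rng_mul_ghost (e : A) : vertex K E (E.rng e) * ghost K E e = ghost K E e :=
  mk_eq_mk K E (.rng_ghost e)

@[simp]
theorem ghost_mul_vertex_src (e : A) : ghost K E e * vertex K E (E.src e) = ghost K E e :=
  mk_eq_mk K E (.ghost_src e)

@[simp]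
theorem ghost_mul_edge_self (e : A) : ghost K E e * edge K E e = vertex K E (E.rng e) :=
  mk_eq_mk K E (.ghost_edge_self e)

theorem ghost_mul_edge_of_ne {e f : A} (h : e ≠ f) : ghost K E e * edge K E f = 0 :=
  mk_eq_mk K E (.ghost_edge_ne e f h)

theorem vertex_eq_sum (v : V) (hfin : (E.src ⁻¹' {v}).Finite) (hne : (E.src ⁻¹' {v}).Nonempty) :
    vertex K E v = ∑ e ∈ hfin.toFinset, edge K E e * ghost K E e := by
  have h := mk_eq_mk K E (.regular v hfin hne)
  rw [map_sum] at h
  exact h.trans (Finset.sum_congr rfl fun e _ => map_mul _ _ _)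

theorem vertex_mul_edge_of_ne {v : V} {e : A} (h : v ≠ E.src e) :
    vertex K E v * edge K E e = 0 := by
  rw [← vertex_src_mul_edge, ← mul_assoc, vertex_mul_vertex_of_ne K E h, zero_mul]

theorem edge_mul_vertex_of_ne {v : V} {e : A} (h : E.rng e ≠ v) :
    edge K E e * vertex K E v = 0 := by
  rw [← edge_mul_vertex_rng, mul_assoc, vertex_mul_vertex_of_ne K E h, mul_zero]

theorem ghost_mul_vertex_of_ne {v : V} {e : A} (h : E.src e ≠ v) :
    ghost K E e * vertex K E v = 0 := by
  rw [← ghost_mul_vertex_src, mul_assoc, vertex_mul_vertex_of_ne K E h, mul_zero]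

variable {K E}

theorem mk_smul (k : K) (x : LeavittFree K V A) : mk K E (k • x) = k • mk K E x := rfl

/-- Induction on `L_K(E)` as an algebra generated by vertices, edges and ghost edges. -/
@[elab_as_elim]
theorem induction {p : LeavittPathAlgebra K E → Prop} (x : LeavittPathAlgebra K E)
    (zero : p 0) (vertex : ∀ v, p (vertex K E v)) (edge : ∀ e, p (edge K E e))
    (ghost : ∀ e, p (ghost K E e)) (add : ∀ x y, p x → p y → p (x + y))
    (mul : ∀ x y, p x → p y → p (x * y)) (smul : ∀ (k : K) x, p x → p (k • x)) : p x := by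
  obtain ⟨x, rfl⟩ := mk_surjective K E x
  induction x using MonoidAlgebra.induction_linear with
  | zero => rw [map_zero]; exact zero
  | add x y hx hy => rw [map_add]; exact add _ _ hx hy
  | single m k =>
    have h : (MonoidAlgebra.single m k : LeavittFree K V A) = k • MonoidAlgebra.single m 1 := by
      rw [MonoidAlgebra.smul_single, smul_eq_mul, mul_one]
    rw [h, mk_smul]
    refine smul _ _ ?_
    clear h
    have hgen : ∀ g, p (mk K E (LeavittFree.gen K g)) := by
      rintro (v | e | e)
      exacts [vertex v, edge e, ghost e]
    induction m using FreeSemigroup.recOnMul with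
    | ih1 g => exact hgen g
    | ih2 g m hg hm =>
      have h : (MonoidAlgebra.single (FreeSemigroup.of g * m) 1 : LeavittFree K V A) =
          LeavittFree.gen K g * MonoidAlgebra.single m 1 := by
        rw [LeavittFree.gen, MonoidAlgebra.single_mul_single, mul_one]
      rw [h, map_mul]
      exact mul _ _ (hgen g) hm

theorem sum_vertex_mul_of_absorb {u : V} {x : LeavittPathAlgebra K E} (h : vertex K E u * x = x)
    {F : Finset V} (hu : u ∈ F) : (∑ v ∈ F, vertex K E v) * x = x := by
  rw [← h, ← mul_assoc, Finset.sum_mul, Finset.sum_eq_single_of_mem u hu, vertex_mul_self]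
  intro v _ hv
  exact vertex_mul_vertex_of_ne K E hv

theorem mul_sum_vertex_of_absorb {u : V} {x : LeavittPathAlgebra K E} (h : x * vertex K E u = x)
    {F : Finset V} (hu : u ∈ F) : x * (∑ v ∈ F, vertex K E v) = x := by
  rw [← h, mul_assoc, Finset.mul_sum, Finset.sum_eq_single_of_mem u hu, vertex_mul_self]
  intro v _ hv
  exact vertex_mul_vertex_of_ne K E hv.symm

/-- Finite sums of vertices are left units for `L_K(E)`. -/
theorem exists_sum_vertex_mul (x : LeavittPathAlgebra K E) :
    ∃ F : Finset V, ∀ F', F ⊆ F' → (∑ v ∈ F', vertex K E v) * x = x := by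
  classical
  induction x using induction with
  | zero => exact ⟨∅, fun _ _ => mul_zero _⟩
  | vertex v =>
    exact ⟨{v}, fun F hF => sum_vertex_mul_of_absorb (vertex_mul_self K E v)
      (by simpa using hF)⟩
  | edge e =>
    exact ⟨{E.src e}, fun F hF => sum_vertex_mul_of_absorb (vertex_src_mul_edge K E e)
      (by simpa using hF)⟩
  | ghost e =>
    exact ⟨{E.rng e}, fun F hF => sum_vertex_mul_of_absorb (vertex_rng_mul_ghost K E e)
      (by simpa using hF)⟩
  | add x y hx hy =>
    obtain ⟨F, hF⟩ := hx
    obtain ⟨G, hG⟩ := hy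
    -- Having the identity for all larger sets, not only for one, lets both summands share `F ∪ G`.
    refine ⟨F ∪ G, fun H hH => ?_⟩
    rw [mul_add, hF H (Finset.union_subset_left hH), hG H (Finset.union_subset_right hH)]
  | mul x y hx hy =>
    obtain ⟨F, hF⟩ := hx
    exact ⟨F, fun H hH => by rw [← mul_assoc, hF H hH]⟩
  | smul k x hx =>
    obtain ⟨F, hF⟩ := hx
    exact ⟨F, fun H hH => by rw [mul_smul_comm, hF H hH]⟩

/-- Finite sums of vertices are right units for `L_K(E)`. -/
theorem exists_mul_sum_vertex (x : LeavittPathAlgebra K E) :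
    ∃ F : Finset V, ∀ F', F ⊆ F' → x * (∑ v ∈ F', vertex K E v) = x := by
  classical
  induction x using induction with
  | zero => exact ⟨∅, fun _ _ => zero_mul _⟩
  | vertex v =>
    exact ⟨{v}, fun F hF => mul_sum_vertex_of_absorb (vertex_mul_self K E v)
      (by simpa using hF)⟩
  | edge e =>
    exact ⟨{E.rng e}, fun F hF => mul_sum_vertex_of_absorb (edge_mul_vertex_rng K E e)
      (by simpa using hF)⟩
  | ghost e =>
    exact ⟨{E.src e}, fun F hF => mul_sum_vertex_of_absorb (ghost_mul_vertex_src K E e)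
      (by simpa using hF)⟩
  | add x y hx hy =>
    obtain ⟨F, hF⟩ := hx
    obtain ⟨G, hG⟩ := hy
    refine ⟨F ∪ G, fun H hH => ?_⟩
    rw [add_mul, hF H (Finset.union_subset_left hH), hG H (Finset.union_subset_right hH)]
  | mul x y hx hy =>
    obtain ⟨F, hF⟩ := hy
    exact ⟨F, fun H hH => by rw [mul_assoc, hF H hH]⟩
  | smul k x hx =>
    obtain ⟨F, hF⟩ := hx
    exact ⟨F, fun H hH => by rw [smul_mul_assoc, hF H hH]⟩

theorem exists_left_unit (x : LeavittPathAlgebra K E) : ∃ a, a * x = x :=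
  let ⟨F, hF⟩ := exists_sum_vertex_mul x
  ⟨_, hF F subset_rfl⟩

theorem exists_mul_vertex_ne_zero {x : LeavittPathAlgebra K E} (hx : x ≠ 0) :
    ∃ v, x * vertex K E v ≠ 0 := by
  by_contra! h
  obtain ⟨F, hF⟩ := exists_mul_sum_vertex x
  apply hx
  rw [← hF F subset_rfl, Finset.mul_sum, Finset.sum_eq_zero fun v _ => h v]

end Basic

/-! ### Paths and ghost paths as elements of the algebra. -/

section Paths

variable (K : Type*) [Field K] {V : Type*} {A : Type*} (E : DirGraph V A)

/-- The element `e₁ ⋯ eₙ w` of `L_K(E)`. -/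
noncomputable def path (μ : List A) (w : V) : LeavittPathAlgebra K E :=
  μ.foldr (fun e x => edge K E e * x) (vertex K E w)

/-- The element `w eₙ^* ⋯ e₁^*` of `L_K(E)`. -/
noncomputable def ghostPath (w : V) (μ : List A) : LeavittPathAlgebra K E :=
  μ.foldr (fun e x => x * ghost K E e) (vertex K E w)

@[simp]
theorem path_nil (w : V) : path K E [] w = vertex K E w := rfl

@[simp]
theorem path_cons (e : A) (μ : List A) (w : V) :
    path K E (e :: μ) w = edge K E e * path K E μ w := rfl

@[simp]
theorem ghostPath_nil (w : V) : ghostPath K E w [] = vertex K E w := rfl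

@[simp]
theorem ghostPath_cons (e : A) (μ : List A) (w : V) :
    ghostPath K E w (e :: μ) = ghostPath K E w μ * ghost K E e := rfl

@[simp]
theorem path_mul_vertex (μ : List A) (w : V) : path K E μ w * vertex K E w = path K E μ w := by
  induction μ with
  | nil => simp
  | cons e μ ih => rw [path_cons, mul_assoc, ih]

theorem path_mul_vertex_of_ne (μ : List A) {v w : V} (h : w ≠ v) :
    path K E μ w * vertex K E v = 0 := by
  rw [← path_mul_vertex, mul_assoc, vertex_mul_vertex_of_ne K E h, mul_zero]

variable {E}

theorem vertex_mul_path {u v : V} {μ : List A} (h : E.IsPath u μ v) :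
    vertex K E u * path K E μ v = path K E μ v := by
  cases h with
  | nil => simp
  | cons e μ w _ => rw [path_cons, ← mul_assoc, vertex_src_mul_edge]

theorem ghostPath_mul_vertex {u v : V} {μ : List A} (h : E.IsPath u μ v) :
    ghostPath K E v μ * vertex K E u = ghostPath K E v μ := by
  cases h with
  | nil => simp
  | cons e μ w _ => rw [ghostPath_cons, mul_assoc, ghost_mul_vertex_src]

theorem path_mul_path (μ : List A) {ν : List A} {v w : V} (h : E.IsPath v ν w) :
    path K E μ v * path K E ν w = path K E (μ ++ ν) w := by
  induction μ with
  | nil => exact vertex_mul_path K h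
  | cons e μ ih => rw [path_cons, List.cons_append, path_cons, mul_assoc, ih]

theorem path_mul_edge (μ : List A) (e : A) :
    path K E μ (E.src e) * edge K E e = path K E (μ ++ [e]) (E.rng e) := by
  rw [← path_mul_path K μ (.cons e [] _ (.nil _)), path_cons, path_nil, edge_mul_vertex_rng]

theorem path_eq_zero_or (μ : List A) (w : V) : path K E μ w = 0 ∨ ∃ u, E.IsPath u μ w := by
  induction μ with
  | nil => exact .inr ⟨w, .nil w⟩
  | cons e μ ih =>
    rcases ih with h | ⟨u, hu⟩
    · exact .inl (by rw [path_cons, h, mul_zero])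
    · by_cases he : E.rng e = u
      · subst he
        exact .inr ⟨_, .cons _ _ _ hu⟩
      · left
        rw [path_cons, ← vertex_mul_path K hu, ← mul_assoc, edge_mul_vertex_of_ne K E he, zero_mul]

-- Each ghost edge cancels an equal leading edge and kills a different one; the length bound ensures
-- that the ghost path is used up. The condition `x = y` matters only for empty `τ`, which is a
-- prefix of everything.
open Classical in
theorem ghostPath_mul_path {x y u w : V} {τ σ : List A} (hτ : E.IsPath x τ u)
    (hσ : E.IsPath y σ w) (hl : τ.length ≤ σ.length) :
    ghostPath K E u τ * path K E σ w =
      if x = y ∧ τ <+: σ then path K E (σ.drop τ.length) w else 0 := by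
  induction hτ generalizing y σ with
  | nil v =>
    by_cases h : v = y
    · subst h
      simpa using vertex_mul_path K hσ
    · rw [if_neg (by tauto), ← vertex_mul_path K hσ, ← mul_assoc, ghostPath_nil,
        vertex_mul_vertex_of_ne K E h, zero_mul]
  | cons e τ u hτ ih =>
    cases hσ with
    | nil => simp at hl
    | cons f σ w hσ =>
      rw [ghostPath_cons, path_cons, mul_assoc, ← mul_assoc (ghost K E e)]
      by_cases h : e = f
      · subst h
        rw [ghost_mul_edge_self, vertex_mul_path K hσ, ih hσ (by simpa using hl)]
        simp
      · rw [ghost_mul_edge_of_ne K E h, zero_mul, mul_zero, if_neg]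
        simp [h]

theorem ghostPath_mul_path_self {u v : V} {τ : List A} (hτ : E.IsPath u τ v) :
    ghostPath K E v τ * path K E τ v = vertex K E v := by
  simp [ghostPath_mul_path K hτ hτ le_rfl]

end Paths

end LeavittPathAlgebra

/-! ### Infinite paths of the graph with loops added at singular vertices. -/

namespace DirGraph

variable {V : Type*} {A : Type*} (E : DirGraph V A)

/-- The graph `E` is enlarged by a loop at every vertex; this is the source map. -/
def extSrc : A ⊕ V → V := Sum.elim E.src id

/-- The graph `E` is enlarged by a loop at every vertex; this is the range map. -/
def extRng : A ⊕ V → V := Sum.elim E.rng id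

/-- The added loop may be used at singular vertices only. -/
def Allowed : A ⊕ V → Prop :=
  Sum.elim (fun _ => True) fun v => ¬ ((E.src ⁻¹' {v}).Finite ∧ (E.src ⁻¹' {v}).Nonempty)

/-- The first steps of the sequence `p` form a path of allowed edges of the enlarged graph. -/
def IsTrailUpTo : ℕ → Stream' (A ⊕ V) → Prop
  | 0, p => E.Allowed p.head
  | n + 1, p => E.Allowed p.head ∧ E.extSrc p.tail.head = E.extRng p.head ∧ IsTrailUpTo n p.tail

/-- An infinite path of allowed edges of the enlarged graph. -/
def IsTrail (p : Stream' (A ⊕ V)) : Prop := ∀ n, E.IsTrailUpTo n p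

variable {E}

theorem isTrail_iff {p : Stream' (A ⊕ V)} :
    E.IsTrail p ↔ E.Allowed p.head ∧ E.extSrc p.tail.head = E.extRng p.head ∧
      E.IsTrail p.tail :=
  ⟨fun h => ⟨h 0, (h 1).2.1, fun n => (h (n + 1)).2.2⟩, fun ⟨h₁, h₂, h₃⟩ n => by
    cases n with
    | zero => exact h₁
    | succ n => exact ⟨h₁, h₂, h₃ n⟩⟩

theorem isTrail_cons_inl {e : A} {p : Stream' (A ⊕ V)} :
    E.IsTrail (Stream'.cons (.inl e) p) ↔ E.extSrc p.head = E.rng e ∧ E.IsTrail p := by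
  rw [isTrail_iff, Stream'.tail_cons, Stream'.head_cons]
  simp [Allowed, extRng]

theorem IsTrailUpTo.mono {n : ℕ} {p : Stream' (A ⊕ V)} (h : E.IsTrailUpTo (n + 1) p) :
    E.IsTrailUpTo n p := by
  induction n generalizing p with
  | zero => exact h.1
  | succ n ih => exact ⟨h.1, h.2.1, ih h.2.2⟩

-- A regular vertex emits an edge and a singular one has its added loop, so a walk never gets stuck,
-- even at a sink.
variable (E) in
theorem exists_isTrail (v : V) : ∃ p, E.IsTrail p ∧ E.extSrc p.head = v := by
  have h : ∀ v, ∃ a, E.Allowed a ∧ E.extSrc a = v := by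
    intro v
    by_cases hv : (E.src ⁻¹' {v}).Finite ∧ (E.src ⁻¹' {v}).Nonempty
    · obtain ⟨e, he⟩ := hv.2
      exact ⟨.inl e, trivial, he⟩
    · exact ⟨.inr v, hv, rfl⟩
  choose g hg hgs using h
  have key : ∀ n a, E.Allowed a →
      E.IsTrailUpTo n (Stream'.iterate (fun a => g (E.extRng a)) a) := by
    intro n
    induction n with
    | zero => exact fun a ha => ha
    | succ n ih =>
      intro a ha
      rw [Stream'.iterate_eq]
      exact ⟨ha, hgs _, ih _ (hg _)⟩
  exact ⟨_, fun n => key n (g v) (hg v), hgs v⟩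

theorem IsPath.extSrc_append {u v : V} {μ : List A} (h : E.IsPath u μ v) {p : Stream' (A ⊕ V)}
    (hp : E.extSrc p.head = v) : E.extSrc (μ.map Sum.inl ++ₛ p).head = u := by
  cases h with
  | nil => exact hp
  | cons e μ w _ => rfl

theorem IsPath.isTrailUpTo_append {u v : V} {μ : List A} (h : E.IsPath u μ v)
    {p : Stream' (A ⊕ V)} (hp : E.extSrc p.head = v) {n : ℕ} (hn : E.IsTrailUpTo n p) :
    E.IsTrailUpTo (n + μ.length) (μ.map Sum.inl ++ₛ p) := by
  induction h with
  | nil => exact hn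
  | cons e μ w h ih => exact ⟨trivial, h.extSrc_append hp, ih hp⟩

/-- The infinite path `γ γ γ ⋯`. -/
def cyclePath (γ : List A) (hγ : γ ≠ []) : Stream' (A ⊕ V) :=
  Stream'.cycle (γ.map Sum.inl) (by simpa using hγ)

theorem append_cyclePath (γ : List A) (hγ : γ ≠ []) :
    γ.map Sum.inl ++ₛ (cyclePath γ hγ : Stream' (A ⊕ V)) = cyclePath γ hγ :=
  (Stream'.cycle_eq _ _).symm

theorem extSrc_head_cyclePath {v : V} {γ : List A} (hγ : γ ≠ []) (h : E.IsPath v γ v) :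
    E.extSrc (cyclePath γ hγ).head = v := by
  rw [← append_cyclePath]
  cases h with
  | nil => exact absurd rfl hγ
  | cons e μ w _ => rfl

theorem isTrail_cyclePath {v : V} {γ : List A} (hγ : γ ≠ []) (h : E.IsPath v γ v) :
    E.IsTrail (cyclePath γ hγ) := by
  intro n
  induction n with
  | zero =>
    rw [← append_cyclePath]
    cases h with
    | nil => exact absurd rfl hγ
    | cons e μ w _ => trivial
  | succ n ih =>
    have h₁ := h.isTrailUpTo_append (extSrc_head_cyclePath hγ h) ih
    rw [append_cyclePath] at h₁
    -- Prepending `γ` gains as many steps as `γ` has edges; only one is needed, so the surplus is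
    -- dropped.
    have h₂ : ∀ k, E.IsTrailUpTo (n + (k + 1)) (cyclePath γ hγ) →
        E.IsTrailUpTo (n + 1) (cyclePath γ hγ) := by
      intro k
      induction k with
      | zero => exact id
      | succ k ih => exact fun h => ih h.mono
    obtain ⟨k, hk⟩ := Nat.exists_eq_succ_of_ne_zero (List.length_pos_iff.2 hγ).ne'
    rw [hk] at h₁
    exact h₂ k h₁

/-- `γ γ γ ⋯` is the only sequence that is fixed by prepending `γ`. -/
theorem eq_cyclePath {γ : List A} (hγ : γ ≠ []) {p : Stream' (A ⊕ V)}
    (hp : γ.map Sum.inl ++ₛ p = p) : p = cyclePath γ hγ := by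
  have key : ∀ n, p.get n = (cyclePath γ hγ : Stream' (A ⊕ V)).get n := by
    intro n
    induction n using Nat.strong_induction_on with
    | _ n ih =>
      -- Entries inside the first copy of `γ` agree; later ones reduce to an index smaller by the
      -- length of `γ`.
      rw [← hp, ← append_cyclePath]
      by_cases hn : n < (γ.map (Sum.inl : A → A ⊕ V)).length
      · rw [Stream'.get_append_left _ _ _ hn, Stream'.get_append_left _ _ _ hn]
      · obtain ⟨m, rfl⟩ := Nat.exists_eq_add_of_le (not_lt.1 hn)
        rw [Stream'.get_append_right, Stream'.get_append_right]
        refine ih m ?_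
        have := List.length_pos_iff.2 hγ
        rw [List.length_map]
        omega
  exact Stream'.ext key

/-- Commutation makes `δ γ γ ⋯` invariant under prepending `γ`, and only `γ γ ⋯` is. -/
theorem append_cyclePath_of_commute {γ δ : List A} (hγ : γ ≠ []) (h : δ ++ γ = γ ++ δ) :
    δ.map Sum.inl ++ₛ (cyclePath γ hγ : Stream' (A ⊕ V)) = cyclePath γ hγ := by
  apply eq_cyclePath hγ
  rw [← Stream'.append_append_stream, ← List.map_append, ← h, List.map_append,
    Stream'.append_append_stream, append_cyclePath]

end DirGraph

/-! ### The representation on functions on infinite paths. -/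

namespace LeavittPathAlgebra

section Representation

variable (K : Type*) [Field K] {V : Type*} {A : Type*} (E : DirGraph V A)

/-- The module of functions on all sequences of edges of the enlarged graph. -/
abbrev TrailModule (K : Type*) [Field K] (V : Type*) (A : Type*) := Stream' (A ⊕ V) → K[T;T⁻¹]

/-- The algebra of endomorphisms of `TrailModule`. -/
abbrev TrailEnd (K : Type*) [Field K] (V : Type*) (A : Type*) :=
  Module.End K[T;T⁻¹] (TrailModule K V A)

open Classical in
/-- A vertex acts as the restriction to the infinite paths that start there. -/
noncomputable def trailVertex (v : V) : TrailEnd K V A where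
  toFun f p := if E.IsTrail p ∧ E.extSrc p.head = v then f p else 0
  map_add' f g := by ext1 p; simp only [Pi.add_apply]; split_ifs <;> simp
  map_smul' c f := by ext1 p; simp only [Pi.smul_apply]; split_ifs <;> simp

open Classical in
/-- An edge acts as a shift, weighted by `T`. -/
noncomputable def trailEdge (e : A) : TrailEnd K V A where
  toFun f p := if E.IsTrail p ∧ p.head = .inl e then .T 1 * f p.tail else 0
  map_add' f g := by ext1 p; simp only [Pi.add_apply]; split_ifs <;> simp [mul_add]
  map_smul' c f := by
    ext1 p
    simp only [Pi.smul_apply, smul_eq_mul, RingHom.id_apply]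
    split_ifs
    exacts [mul_left_comm _ _ _, (mul_zero _).symm]

open Classical in
/-- A ghost edge acts as a shift, weighted by `T⁻¹`. -/
noncomputable def trailGhost (e : A) : TrailEnd K V A where
  toFun f p :=
    if E.IsTrail p ∧ E.extSrc p.head = E.rng e then .T (-1) * f (Stream'.cons (.inl e) p) else 0
  map_add' f g := by ext1 p; simp only [Pi.add_apply]; split_ifs <;> simp [mul_add]
  map_smul' c f := by
    ext1 p
    simp only [Pi.smul_apply, smul_eq_mul, RingHom.id_apply]
    split_ifs
    exacts [mul_left_comm _ _ _, (mul_zero _).symm]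

/-- The action of the generators. -/
noncomputable def trailGen : LeavittGen V A → TrailEnd K V A
  | .vertex v => trailVertex K E v
  | .edge e => trailEdge K E e
  | .ghost e => trailGhost K E e

/-- The action of the free algebra. -/
noncomputable def trailFree : LeavittFree K V A →ₙₐ[K] TrailEnd K V A :=
  MonoidAlgebra.liftMagma K (FreeSemigroup.lift (trailGen K E))

theorem trailFree_gen (g : LeavittGen V A) :
    trailFree K E (LeavittFree.gen K g) = trailGen K E g := by
  simp [trailFree, LeavittFree.gen, MonoidAlgebra.liftMagma]

theorem T_one_mul_T_neg_one_mul (x : K[T;T⁻¹]) : .T 1 * (.T (-1) * x) = x := by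
  rw [← mul_assoc, ← LaurentPolynomial.T_add]; simp

theorem T_neg_one_mul_T_one_mul (x : K[T;T⁻¹]) : .T (-1) * (.T 1 * x) = x := by
  rw [← mul_assoc, ← LaurentPolynomial.T_add]; simp

variable {K E}

theorem trailFree_eq_of_rel {x y : LeavittFree K V A} (h : LeavittRel K E x y) :
    trailFree K E x = trailFree K E y := by
  classical
  induction h with
  | idem v =>
    rw [map_mul, trailFree_gen]
    ext1 f; funext p
    simp only [trailGen, trailVertex, Module.End.mul_apply, LinearMap.coe_mk, AddHom.coe_mk]
    split_ifs <;> rfl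
  | orth v w h =>
    rw [map_mul, trailFree_gen, trailFree_gen, map_zero]
    ext1 f; funext p
    simp only [trailGen, trailVertex, Module.End.mul_apply, LinearMap.coe_mk, AddHom.coe_mk]
    split_ifs <;> first | rfl | (exfalso; grind)
  | src_edge e =>
    rw [map_mul, trailFree_gen, trailFree_gen]
    ext1 f; funext p
    simp only [trailGen, trailVertex, trailEdge, Module.End.mul_apply, LinearMap.coe_mk,
      AddHom.coe_mk]
    by_cases h : E.IsTrail p ∧ p.head = .inl e
    · rw [if_pos ⟨h.1, by rw [h.2]; rfl⟩]
    · rw [if_neg h, ite_self]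
  | edge_rng e =>
    rw [map_mul, trailFree_gen, trailFree_gen]
    ext1 f; funext p
    simp only [trailGen, trailVertex, trailEdge, Module.End.mul_apply, LinearMap.coe_mk,
      AddHom.coe_mk]
    by_cases h : E.IsTrail p ∧ p.head = .inl e
    · obtain ⟨h₁, h₂, h₃⟩ := DirGraph.isTrail_iff.1 h.1
      rw [if_pos h, if_pos h, if_pos ⟨h₃, by rw [h₂, h.2]; rfl⟩]
    · rw [if_neg h, if_neg h]
  | rng_ghost e =>
    rw [map_mul, trailFree_gen, trailFree_gen]
    ext1 f; funext p
    simp only [trailGen, trailVertex, trailGhost, Module.End.mul_apply, LinearMap.coe_mk,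
      AddHom.coe_mk]
    split_ifs <;> rfl
  | ghost_src e =>
    rw [map_mul, trailFree_gen, trailFree_gen]
    ext1 f; funext p
    simp only [trailGen, trailVertex, trailGhost, Module.End.mul_apply, LinearMap.coe_mk,
      AddHom.coe_mk]
    by_cases h : E.IsTrail p ∧ E.extSrc p.head = E.rng e
    · rw [if_pos h, if_pos h, if_pos ⟨DirGraph.isTrail_cons_inl.2 h.symm, rfl⟩]
    · rw [if_neg h, if_neg h]
  | ghost_edge_self e =>
    rw [map_mul, trailFree_gen, trailFree_gen, trailFree_gen]
    ext1 f; funext p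
    simp only [trailGen, trailVertex, trailEdge, trailGhost, Module.End.mul_apply,
      LinearMap.coe_mk, AddHom.coe_mk]
    by_cases h : E.IsTrail p ∧ E.extSrc p.head = E.rng e
    · rw [if_pos h, if_pos h, if_pos ⟨DirGraph.isTrail_cons_inl.2 h.symm, rfl⟩,
        T_neg_one_mul_T_one_mul, Stream'.tail_cons]
    · rw [if_neg h, if_neg h]
  | ghost_edge_ne e f hne =>
    rw [map_mul, trailFree_gen, trailFree_gen, map_zero]
    ext1 f; funext p
    simp only [trailGen, trailEdge, trailGhost, Module.End.mul_apply,
      LinearMap.coe_mk, AddHom.coe_mk, Stream'.head_cons, Sum.inl.injEq, hne, and_false, if_false,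
      mul_zero, ite_self]
    rfl
  | regular v hfin hne =>
    rw [map_sum, trailFree_gen]
    ext1 f; funext p
    simp only [map_mul, trailFree_gen, trailGen, trailVertex, trailEdge, trailGhost,
      Module.End.mul_apply, LinearMap.coe_mk, AddHom.coe_mk, LinearMap.sum_apply,
      Finset.sum_apply]
    by_cases h : E.IsTrail p ∧ E.extSrc p.head = v
    · obtain ⟨h₁, h₂, h₃⟩ := DirGraph.isTrail_iff.1 h.1
      rw [if_pos h]
      -- The trail starts with exactly one edge, so one summand survives; the added loop is not
      -- allowed at a regular vertex.
      rcases hp : p.head with e | w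
      · rw [hp] at h₂
        have he : E.src e = v := by rw [← h.2, hp]; rfl
        rw [Finset.sum_eq_single_of_mem e (by simpa using he), if_pos ⟨h.1, rfl⟩,
          if_pos ⟨h₃, h₂⟩, T_one_mul_T_neg_one_mul, ← hp, Stream'.eta]
        intro f _ hf
        rw [if_neg]
        rintro ⟨-, h⟩
        exact hf (Sum.inl_injective h).symm
      · have hw : w = v := by rw [← h.2, hp]; rfl
        rw [hp, hw] at h₁
        exact absurd ⟨hfin, hne⟩ h₁
    · rw [if_neg h, Finset.sum_eq_zero]
      intro e he
      rw [if_neg]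
      rintro ⟨h₁, h₂⟩
      refine h ⟨h₁, ?_⟩
      rw [h₂]
      exact (by simpa using he : E.src e = v)
  | smul k x y _ ih => rw [map_smul, map_smul, ih]

theorem trailFree_eq_of_con {x y : LeavittFree K V A} (h : leavittCon K E x y) :
    trailFree K E x = trailFree K E y := by
  change RingConGen.Rel (LeavittRel K E) x y at h
  induction h with
  | of x y h => exact trailFree_eq_of_rel h
  | refl x => rfl
  | symm _ ih => exact ih.symm
  | trans _ _ ih₁ ih₂ => exact ih₁.trans ih₂
  | add _ _ ih₁ ih₂ => rw [map_add, map_add, ih₁, ih₂]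
  | mul _ _ ih₁ ih₂ => rw [map_mul, map_mul, ih₁, ih₂]

variable (K E)

/-- The action of `L_K(E)` on the functions on infinite paths of the enlarged graph. -/
noncomputable def trailRep : LeavittPathAlgebra K E →ₙₐ[K] TrailEnd K V A where
  toFun := Quotient.lift (trailFree K E) fun _ _ h => trailFree_eq_of_con h
  map_zero' := map_zero (trailFree K E)
  map_add' x y := by
    obtain ⟨x, rfl⟩ := mk_surjective K E x
    obtain ⟨y, rfl⟩ := mk_surjective K E y
    exact map_add (trailFree K E) x y
  map_mul' x y := by
    obtain ⟨x, rfl⟩ := mk_surjective K E x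
    obtain ⟨y, rfl⟩ := mk_surjective K E y
    exact map_mul (trailFree K E) x y
  map_smul' k x := by
    obtain ⟨x, rfl⟩ := mk_surjective K E x
    exact map_smul (trailFree K E) k x

theorem trailRep_vertex (v : V) : trailRep K E (vertex K E v) = trailVertex K E v :=
  trailFree_gen K E _

theorem trailRep_edge (e : A) : trailRep K E (edge K E e) = trailEdge K E e :=
  trailFree_gen K E _

open Classical in
theorem trailRep_vertex_single {v : V} {p : Stream' (A ⊕ V)} (hp : E.IsTrail p)
    (h : E.extSrc p.head = v) :
    trailRep K E (vertex K E v) (Pi.single p 1) = Pi.single p 1 := by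
  rw [trailRep_vertex]
  funext q
  simp only [trailVertex, LinearMap.coe_mk, AddHom.coe_mk]
  by_cases hq : q = p
  · subst hq
    rw [if_pos ⟨hp, h⟩]
  · rw [Pi.single_eq_of_ne hq, ite_self]

open Classical in
theorem trailRep_edge_single {e : A} {p : Stream' (A ⊕ V)} (hp : E.IsTrail p)
    (h : E.extSrc p.head = E.rng e) :
    trailRep K E (edge K E e) (Pi.single p 1) =
      (.T 1 : K[T;T⁻¹]) • Pi.single (Stream'.cons (.inl e) p) 1 := by
  rw [trailRep_edge]
  funext q
  simp only [trailEdge, LinearMap.coe_mk, AddHom.coe_mk, Pi.smul_apply, smul_eq_mul]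
  by_cases hq : q = Stream'.cons (.inl e) p
  · subst hq
    rw [if_pos ⟨DirGraph.isTrail_cons_inl.2 ⟨h, hp⟩, rfl⟩, Stream'.tail_cons,
      Pi.single_eq_same, Pi.single_eq_same]
  · rw [Pi.single_eq_of_ne hq, mul_zero]
    split_ifs with h'
    · rw [Pi.single_eq_of_ne, mul_zero]
      rintro rfl
      exact hq (by rw [← h'.2, Stream'.eta])
    · rfl

open Classical in
theorem trailRep_path_single {u v : V} {μ : List A} (hμ : E.IsPath u μ v)
    {p : Stream' (A ⊕ V)} (hp : E.IsTrail p) (h : E.extSrc p.head = v) :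
    E.IsTrail (μ.map Sum.inl ++ₛ p) ∧ trailRep K E (path K E μ v) (Pi.single p 1) =
      (.T μ.length : K[T;T⁻¹]) • Pi.single (μ.map Sum.inl ++ₛ p) 1 := by
  induction hμ with
  | nil v => exact ⟨hp, by simpa using trailRep_vertex_single K E hp h⟩
  | cons e μ w hμ ih =>
    obtain ⟨ih₁, ih₂⟩ := ih h
    have hs := hμ.extSrc_append h
    refine ⟨DirGraph.isTrail_cons_inl.2 ⟨hs, ih₁⟩, ?_⟩
    rw [path_cons, map_mul, Module.End.mul_apply, ih₂, map_smul,
      trailRep_edge_single K E ih₁ hs, smul_smul, ← LaurentPolynomial.T_add, List.length_cons,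
      Nat.cast_succ]
    rfl

/-- Some trail starts at `v`, and `v` fixes the delta function there. -/
theorem vertex_ne_zero (v : V) : vertex K E v ≠ 0 := by
  classical
  intro h
  obtain ⟨p, hp, hv⟩ := E.exists_isTrail v
  have h₁ := trailRep_vertex_single K E hp hv
  rw [h, map_zero] at h₁
  have h₂ := congrFun h₁ p
  rw [Pi.single_eq_same] at h₂
  exact zero_ne_one h₂

end Representation

end LeavittPathAlgebra

/-! ### Minimal principal left ideals in a ring without unit. -/

section LeftIdeals

variable {R : Type*} [NonUnitalRing R]

theorem mul_mem_leftMultiples (a x : R) : a * x ∈ leftMultiples x := ⟨a, rfl⟩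

theorem leftMultiples_le_of_mem {x y : R} (h : y ∈ leftMultiples x) :
    leftMultiples y ≤ leftMultiples x := by
  rintro _ ⟨a, rfl⟩
  exact isLeftIdeal_leftMultiples x a y h

/-- Without a unit, `y ∈ R y` must be assumed to exclude `R y = 0`; local units provide it later. -/
theorem IsMinimalLeftIdeal.leftMultiples_eq {x y : R} (hx : IsMinimalLeftIdeal (leftMultiples x))
    (hy : y ∈ leftMultiples x) (hy' : y ∈ leftMultiples y) (h0 : y ≠ 0) :
    leftMultiples y = leftMultiples x := by
  refine (hx.2.2 _ (isLeftIdeal_leftMultiples y) (leftMultiples_le_of_mem hy)).resolve_left ?_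
  intro h
  rw [h] at hy'
  exact h0 hy'

/-- The kernel of right multiplication by `b` on `R x` is a left ideal that misses `x`, hence zero.
-/
theorem IsMinimalLeftIdeal.mul_right_injOn {x b : R}
    (hx : IsMinimalLeftIdeal (leftMultiples x)) (hx' : x ∈ leftMultiples x) (h0 : x * b ≠ 0)
    {y : R} (hy : y ∈ leftMultiples x) (hyb : y * b = 0) : y = 0 := by
  let J : AddSubgroup R := leftMultiples x ⊓ (AddMonoidHom.mulRight b).ker
  have hJ : IsLeftIdeal J := by
    rintro a y ⟨hy, hyb⟩
    refine ⟨isLeftIdeal_leftMultiples x a y hy, ?_⟩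
    change a * y * b = 0
    rw [mul_assoc, show y * b = 0 from hyb, mul_zero]
  have hyJ : y ∈ J := ⟨hy, hyb⟩
  rcases hx.2.2 J hJ inf_le_left with h | h
  · rw [h] at hyJ
    exact hyJ
  · rw [← h] at hx'
    exact absurd hx'.2 h0

/-- Right multiplication by `b` is an isomorphism from a minimal left ideal `R x` onto `R x b`,
provided that `x b ≠ 0`. -/
theorem IsMinimalLeftIdeal.leftIdealIso_mul_right {x b : R}
    (hx : IsMinimalLeftIdeal (leftMultiples x)) (hx' : x ∈ leftMultiples x) (h0 : x * b ≠ 0) :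
    LeftIdealIso (leftMultiples x) (leftMultiples (x * b)) (isLeftIdeal_leftMultiples x) := by
  have hmem : ∀ y : leftMultiples x, (y : R) * b ∈ leftMultiples (x * b) := by
    rintro ⟨_, a, rfl⟩
    exact ⟨a, (mul_assoc a x b).symm⟩
  let f : leftMultiples x →+ leftMultiples (x * b) :=
    { toFun := fun y => ⟨y * b, hmem y⟩
      map_zero' := Subtype.ext (zero_mul b)
      map_add' := fun y z => Subtype.ext (add_mul (y : R) z b) }
  have hf : Function.Bijective f := by
    constructor
    · rw [injective_iff_map_eq_zero]
      intro y hy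
      exact Subtype.ext (hx.mul_right_injOn hx' h0 y.2 (congrArg Subtype.val hy))
    · rintro ⟨_, a, rfl⟩
      exact ⟨⟨a * x, mul_mem_leftMultiples a x⟩, Subtype.ext (mul_assoc a x b)⟩
  exact ⟨AddEquiv.ofBijective f hf, fun a y => mul_assoc a y b⟩

/-- A left ideal inside `R x b` is pulled back along right multiplication by `b` to one inside `R
x`. -/
theorem IsMinimalLeftIdeal.mul_right {x b : R}
    (hx : IsMinimalLeftIdeal (leftMultiples x)) (hxb : x * b ∈ leftMultiples (x * b))
    (h0 : x * b ≠ 0) : IsMinimalLeftIdeal (leftMultiples (x * b)) := by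
  refine ⟨isLeftIdeal_leftMultiples _, ?_, fun J hJ hle => ?_⟩
  · intro h
    rw [h] at hxb
    exact h0 hxb
  let I : AddSubgroup R := leftMultiples x ⊓ J.comap (AddMonoidHom.mulRight b)
  have hI : IsLeftIdeal I := by
    rintro a y ⟨hy, hyb⟩
    refine ⟨isLeftIdeal_leftMultiples x a y hy, ?_⟩
    change a * y * b ∈ J
    rw [mul_assoc]
    exact hJ a _ hyb
  rcases hx.2.2 I hI inf_le_left with h | h
  · left
    rw [eq_bot_iff]
    intro y hy
    obtain ⟨a, rfl⟩ := hle hy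
    have ha : a * x ∈ I := ⟨mul_mem_leftMultiples a x, by
      change a * x * b ∈ J
      rw [mul_assoc]
      exact hy⟩
    rw [h] at ha
    change a * (x * b) = 0
    rw [← mul_assoc, show a * x = 0 from ha, zero_mul]
  · right
    refine le_antisymm hle ?_
    rintro _ ⟨a, rfl⟩
    have ha : a * x ∈ I := h ▸ mul_mem_leftMultiples a x
    have := ha.2
    change a * x * b ∈ J at this
    rw [mul_assoc] at this
    exact this

end LeftIdeals

/-! ### Loop forms are not minimal; minimal vertices are line points. -/

namespace LeavittPathAlgebra

variable {K : Type*} [Field K] {V : Type*} {A : Type*} {E : DirGraph V A}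

theorem mem_leftMultiples_self (x : LeavittPathAlgebra K E) : x ∈ leftMultiples x :=
  exists_left_unit x

/-- The factor `b` gives the isomorphism `L x ≅ L x b`; the factor `a` only selects another nonzero
element, hence another generator, of the minimal ideal `L x b`. -/
theorem leftIdealIso_of_mul_mul_ne_zero {x a b : LeavittPathAlgebra K E}
    (hx : IsMinimalLeftIdeal (leftMultiples x)) (h : a * x * b ≠ 0) :
    LeftIdealIso (leftMultiples x) (leftMultiples (a * x * b)) (isLeftIdeal_leftMultiples x) ∧
      IsMinimalLeftIdeal (leftMultiples (a * x * b)) := by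
  rw [mul_assoc] at h ⊢
  have h0 : x * b ≠ 0 := right_ne_zero_of_mul h
  have hmin := hx.mul_right (mem_leftMultiples_self _) h0
  rw [hmin.leftMultiples_eq (mul_mem_leftMultiples _ _) (mem_leftMultiples_self _) h]
  exact ⟨hx.leftIdealIso_mul_right (mem_leftMultiples_self _) h0, hmin⟩

/-- `z = k v + ∑ cᵢ γᵢ` with `k ≠ 0`, where the `γᵢ` are closed paths of positive length at `v`
that commute with a fixed closed path of positive length at `v`. -/
def IsLoopForm (z : LeavittPathAlgebra K E) : Prop :=
  ∃ (v : V) (k : K) (S : Finset (List A)) (c : List A → K) (g : List A → List A) (γ : List A),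
    k ≠ 0 ∧ γ ≠ [] ∧ E.IsPath v γ v ∧
      (∀ i ∈ S, g i ≠ [] ∧ E.IsPath v (g i) v ∧ g i ++ γ = γ ++ g i) ∧
      z = k • vertex K E v + ∑ i ∈ S, c i • path K E (g i) v

open Classical in
/-- An element in loop form and the closed path `γ` commute and have a common eigenvector. -/
theorem IsLoopForm.exists_eigenvector {z : LeavittPathAlgebra K E} (hz : IsLoopForm z) :
    ∃ (y : LeavittPathAlgebra K E) (p : Stream' (A ⊕ V)) (q : K[T;T⁻¹]) (n : ℕ),
      q ≠ 0 ∧ n ≠ 0 ∧ z * y ∈ leftMultiples z ∧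
        trailRep K E z (Pi.single p 1) = q • Pi.single p 1 ∧
        trailRep K E y (Pi.single p 1) = (1 - .T n : K[T;T⁻¹]) • Pi.single p 1 := by
  obtain ⟨v, k, S, c, g, γ, hk, hγ, hγv, hS, rfl⟩ := hz
  have hp := DirGraph.isTrail_cyclePath hγ hγv
  have hs := DirGraph.extSrc_head_cyclePath hγ hγv
  -- The eigenvalue of `z`: each closed path fixes `γ γ ⋯` and contributes `T` to its length.
  -- Positive lengths leave `k` as constant term, so no cancellation can make it zero.
  let P : Polynomial K := k • 1 + ∑ i ∈ S, c i • Polynomial.X ^ (g i).length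
  have hP : P.coeff 0 = k := by
    simp only [P, Polynomial.coeff_add, Polynomial.finsetSum_coeff, Polynomial.coeff_smul,
      Polynomial.coeff_one_zero, smul_eq_mul, mul_one]
    rw [Finset.sum_eq_zero, add_zero]
    intro i hi
    rw [Polynomial.coeff_X_pow, if_neg, mul_zero]
    exact (List.length_pos_iff.2 (hS i hi).1).ne
  refine ⟨vertex K E v - path K E γ v, DirGraph.cyclePath γ hγ, Polynomial.toLaurentAlg P,
    γ.length, ?_, (List.length_pos_iff.2 hγ).ne',
    mem_leftMultiples.2 ⟨vertex K E v - path K E γ v, ?_⟩, ?_, ?_⟩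
  · rw [Polynomial.toLaurentAlg_apply, Polynomial.toLaurent_ne_zero]
    intro h
    rw [h, Polynomial.coeff_zero] at hP
    exact hk hP.symm
  · have hsum : path K E γ v * ∑ i ∈ S, c i • path K E (g i) v =
        (∑ i ∈ S, c i • path K E (g i) v) * path K E γ v := by
      rw [Finset.mul_sum, Finset.sum_mul]
      refine Finset.sum_congr rfl fun i hi => ?_
      rw [mul_smul_comm, smul_mul_assoc, path_mul_path K _ (hS i hi).2.1, path_mul_path K _ hγv,
        (hS i hi).2.2]
    have hv : vertex K E v * ∑ i ∈ S, c i • path K E (g i) v =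
        (∑ i ∈ S, c i • path K E (g i) v) * vertex K E v := by
      rw [Finset.mul_sum, Finset.sum_mul]
      refine Finset.sum_congr rfl fun i hi => ?_
      rw [mul_smul_comm, smul_mul_assoc, vertex_mul_path K (hS i hi).2.1, path_mul_vertex]
    rw [sub_mul, mul_sub, mul_add, mul_add, add_mul, add_mul, hsum, hv, mul_smul_comm,
      mul_smul_comm, smul_mul_assoc, smul_mul_assoc, vertex_mul_path K hγv, path_mul_vertex]
  · simp only [P, map_add, map_sum, map_smul, map_one, map_pow, Polynomial.toLaurentAlg_apply,
      Polynomial.toLaurent_X, LinearMap.add_apply, LinearMap.sum_apply, LinearMap.smul_apply,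
      add_smul, Finset.sum_smul, trailRep_vertex_single K E hp hs, smul_assoc, one_smul]
    congr 1
    refine Finset.sum_congr rfl fun i hi => ?_
    rw [(trailRep_path_single K E (hS i hi).2.1 hp hs).2,
      DirGraph.append_cyclePath_of_commute hγ (hS i hi).2.2, LaurentPolynomial.T_pow, mul_one]
  · rw [map_sub, LinearMap.sub_apply, trailRep_vertex_single K E hp hs,
      (trailRep_path_single K E hγv hp hs).2, DirGraph.append_cyclePath, sub_smul, one_smul]

theorem IsLoopForm.ne_zero {z : LeavittPathAlgebra K E} (hz : IsLoopForm z) : z ≠ 0 := by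
  classical
  rintro rfl
  obtain ⟨y, p, q, n, hq, -, -, h, -⟩ := hz.exists_eigenvector
  rw [map_zero] at h
  have := congrFun h p
  rw [Pi.smul_apply, Pi.single_eq_same, smul_eq_mul, mul_one] at this
  exact hq this.symm

theorem one_sub_T_ne_zero {n : ℕ} (hn : n ≠ 0) : (1 - .T n : K[T;T⁻¹]) ≠ 0 := by
  rw [← Polynomial.toLaurent_X_pow, ← Polynomial.toLaurent_one, ← map_sub,
    Polynomial.toLaurent_ne_zero]
  intro h
  have := congrArg (Polynomial.coeff · 0) h
  simp [Polynomial.coeff_X_pow, hn.symm] at this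

/-- Evaluation at `T = 1` kills the left side. -/
theorem one_sub_T_mul_ne_one (n : ℕ) (s : K[T;T⁻¹]) : (1 - .T n) * s ≠ 1 := by
  intro h
  have := congrArg (LaurentPolynomial.eval₂ (RingHom.id K) 1) h
  rw [map_mul, map_sub, map_one, LaurentPolynomial.eval₂_T_n] at this
  simp at this

theorem IsLoopForm.not_isMinimalLeftIdeal {z : LeavittPathAlgebra K E} (hz : IsLoopForm z) :
    ¬ IsMinimalLeftIdeal (leftMultiples z) := by
  classical
  intro hmin
  obtain ⟨y, p, q, n, hq, hn, hmem, h, hy⟩ := hz.exists_eigenvector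
  have hzy : trailRep K E (z * y) (Pi.single p 1) =
      ((1 - .T n : K[T;T⁻¹]) * q) • Pi.single p 1 := by
    rw [map_mul, Module.End.mul_apply, hy, map_smul, h, smul_smul]
  have hne : z * y ≠ 0 := by
    intro h0
    rw [h0, map_zero] at hzy
    have := congrFun hzy p
    rw [Pi.smul_apply, Pi.single_eq_same, smul_eq_mul, mul_one] at this
    exact mul_ne_zero (one_sub_T_ne_zero hn) hq this.symm
  have hz' := mem_leftMultiples_self z
  rw [← hmin.leftMultiples_eq hmem (mem_leftMultiples_self _) hne] at hz'
  obtain ⟨a, ha⟩ := hz'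
  change a * (z * y) = z at ha
  rw [← ha, map_mul, Module.End.mul_apply, hzy, map_smul] at h
  -- The element `a` may spread the delta function at `p` over other trails; its coefficient at `p`
  -- alone already inverts `1 - T ^ n`.
  have := congrFun h p
  rw [Pi.smul_apply, Pi.smul_apply, Pi.single_eq_same, smul_eq_mul, smul_eq_mul, mul_one,
    mul_right_comm] at this
  exact one_sub_T_mul_ne_one n _ (mul_right_cancel₀ hq (this.trans (one_mul q).symm))

/-- The vertex is itself a loop form, with empty sum and commuting path `γ`. -/
theorem not_isMinimalLeftIdeal_of_isPath {v : V} {γ : List A} (hγ : γ ≠ [])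
    (h : E.IsPath v γ v) : ¬ IsMinimalLeftIdeal (leftMultiples (vertex K E v)) :=
  IsLoopForm.not_isMinimalLeftIdeal
    ⟨v, 1, ∅, 0, id, γ, one_ne_zero, hγ, h, by simp, by simp⟩

/-- For distinct edges `e`, `f` at `v`, minimality gives `v = a e e^*`. Then `f = v f = a e e^* f =
0`, against `f^* f = r(f) ≠ 0`. -/
theorem not_isBifurcation {v : V} (hv : IsMinimalLeftIdeal (leftMultiples (vertex K E v))) :
    ¬ E.IsBifurcation v := by
  rintro ⟨e, rfl, f, hf, hne⟩
  have h0 : edge K E e * ghost K E e ≠ 0 := by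
    intro h
    apply vertex_ne_zero K E (E.rng e)
    rw [← vertex_mul_self, ← ghost_mul_edge_self, mul_assoc, ← mul_assoc (edge K E e), h,
      zero_mul, mul_zero]
  have hmem : edge K E e * ghost K E e ∈ leftMultiples (vertex K E (E.src e)) :=
    mem_leftMultiples.2 ⟨edge K E e * ghost K E e, by rw [mul_assoc, ghost_mul_vertex_src]⟩
  have h := mem_leftMultiples_self (vertex K E (E.src e))
  rw [← hv.leftMultiples_eq hmem (mem_leftMultiples_self _) h0] at h
  obtain ⟨a, ha⟩ := h
  change a * _ = _ at ha
  have hf0 : edge K E f = 0 := by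
    rw [← vertex_src_mul_edge, show E.src f = E.src e from hf, ← ha, mul_assoc, mul_assoc,
      ghost_mul_edge_of_ne K E hne, mul_zero, mul_zero]
  apply vertex_ne_zero K E (E.rng f)
  rw [← ghost_mul_edge_self, hf0, mul_zero]

/-- If `L_K(E) v` is a minimal left ideal, then `v` is a line point. -/
theorem isLinePoint_of_isMinimalLeftIdeal {v : V}
    (hv : IsMinimalLeftIdeal (leftMultiples (vertex K E v))) : E.IsLinePoint v := by
  rintro w ⟨μ, hμ⟩
  -- Every vertex `w` of the tree is a two-sided multiple `μ^* v μ`, so it inherits minimality.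
  have h : ghostPath K E w μ * vertex K E v * path K E μ w = vertex K E w := by
    rw [ghostPath_mul_vertex K hμ, ghostPath_mul_path_self K hμ]
  have hw := (leftIdealIso_of_mul_mul_ne_zero hv (h ▸ vertex_ne_zero K E w)).2
  rw [h] at hw
  exact ⟨not_isBifurcation hw, fun ⟨γ, hγ, hp, _⟩ => not_isMinimalLeftIdeal_of_isPath hγ hp hw⟩

end LeavittPathAlgebra

/-! ### Reducing combinations of paths to a vertex or a loop form. -/

namespace DirGraph

variable {V : Type*} {A : Type*} {E : DirGraph V A}

theorem IsPath.src_unique {u v w : V} {μ : List A} (h : E.IsPath u μ w) (h' : E.IsPath v μ w) :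
    u = v := by
  cases h with
  | nil => exact (isPath_nil_iff.1 h').symm
  | cons e μ w _ => exact (isPath_cons_iff.1 h').1.symm

end DirGraph

namespace LeavittPathAlgebra

section Reduction

variable {K : Type*} [Field K] {V : Type*} {A : Type*} {E : DirGraph V A}

/-- Some two-sided multiple `a y b` is a vertex or in loop form. -/
def IsReducible (y : LeavittPathAlgebra K E) : Prop :=
  ∃ a b, (∃ u, a * y * b = vertex K E u) ∨ IsLoopForm (a * y * b)

theorem IsReducible.of_mul_mul {a y b : LeavittPathAlgebra K E} (h : IsReducible (a * y * b)) :
    IsReducible y := by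
  obtain ⟨a', b', h⟩ := h
  refine ⟨a' * a, b * b', ?_⟩
  rwa [show a' * a * y * (b * b') = a' * (a * y * b) * b' by simp only [mul_assoc]]

theorem exists_right_unit (x : LeavittPathAlgebra K E) : ∃ b, x * b = x :=
  let ⟨F, hF⟩ := exists_mul_sum_vertex x
  ⟨_, hF F subset_rfl⟩

theorem IsReducible.of_mul_left {a y : LeavittPathAlgebra K E} (h : IsReducible (a * y)) :
    IsReducible y := by
  obtain ⟨b, hb⟩ := exists_right_unit (a * y)
  exact .of_mul_mul (hb.symm ▸ h : IsReducible (a * y * b))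

theorem IsReducible.of_mul_right {y b : LeavittPathAlgebra K E} (h : IsReducible (y * b)) :
    IsReducible y := by
  obtain ⟨a, ha⟩ := exists_left_unit (y * b)
  exact .of_mul_mul (a := a) (b := b) (by rwa [mul_assoc, ha])

theorem isReducible_vertex (v : V) : IsReducible (vertex K E v) :=
  ⟨vertex K E v, vertex K E v, .inl ⟨v, by simp⟩⟩

theorem IsLoopForm.isReducible {z : LeavittPathAlgebra K E} (hz : IsLoopForm z) :
    IsReducible z := by
  obtain ⟨a, ha⟩ := exists_left_unit z
  obtain ⟨b, hb⟩ := exists_right_unit z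
  exact ⟨a, b, .inr (by rwa [ha, hb])⟩

theorem IsReducible.ne_zero {y : LeavittPathAlgebra K E} (hy : IsReducible y) : y ≠ 0 := by
  rintro rfl
  obtain ⟨a, b, h⟩ := hy
  rw [mul_zero, zero_mul] at h
  rcases h with ⟨u, hu⟩ | h
  · exact vertex_ne_zero K E u hu.symm
  · exact h.ne_zero rfl

open Classical in
/-- Conjugating a combination of closed paths by a path `τ` keeps the closed paths `γ` for which
`τ` is an initial segment of `γ τ`, and kills the others. -/
theorem ghostPath_mul_add_mul_path {v u : V} {τ : List A} (hτ : E.IsPath v τ u) (k : K)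
    (S : Finset (List A)) (c : List A → K) (g : List A → List A)
    (hg : ∀ i ∈ S, E.IsPath v (g i) v) :
    ghostPath K E u τ * (k • vertex K E v + ∑ i ∈ S, c i • path K E (g i) v) * path K E τ u =
      k • vertex K E u + ∑ i ∈ S.filter (fun i => τ <+: g i ++ τ),
        c i • path K E ((g i ++ τ).drop τ.length) u := by
  rw [mul_add, add_mul, mul_smul_comm, smul_mul_assoc, ghostPath_mul_vertex K hτ,
    ghostPath_mul_path_self K hτ, Finset.mul_sum, Finset.sum_mul, Finset.sum_filter]
  congr 1
  refine Finset.sum_congr rfl fun i hi => ?_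
  rw [mul_smul_comm, smul_mul_assoc, mul_assoc, path_mul_path K _ hτ,
    ghostPath_mul_path K hτ ((hg i hi).append hτ) (by simp)]
  simp only [true_and]
  split_ifs
  · rfl
  · rw [smul_zero]

/-- Induction on the number of closed paths: conjugating by a path `τ` that is not a prefix of some
`γ τ` discards `γ` and keeps the vertex term. Neither distinct paths nor nonzero coefficients are
required, so collisions after conjugation do no harm. -/
theorem isReducible_vertex_add {v : V} {k : K} (hk : k ≠ 0) (S : Finset (List A))
    (c : List A → K) (g : List A → List A) (hg : ∀ i ∈ S, g i ≠ [] ∧ E.IsPath v (g i) v) :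
    IsReducible (k • vertex K E v + ∑ i ∈ S, c i • path K E (g i) v) := by
  classical
  induction hn : S.card using Nat.strong_induction_on generalizing v S g with
  | _ n ih =>
    by_cases h : ∀ i ∈ S, ∀ τ u, E.IsPath v τ u → τ <+: g i ++ τ
    · rcases S.eq_empty_or_nonempty with rfl | ⟨j, hj⟩
      · refine .of_mul_left (a := k⁻¹ • vertex K E v) ?_
        rw [Finset.sum_empty, add_zero, smul_mul_smul_comm, inv_mul_cancel₀ hk, one_smul,
          vertex_mul_self]
        exact isReducible_vertex v
      · refine IsLoopForm.isReducible ⟨v, k, S, c, g, g j, hk, (hg j hj).1, (hg j hj).2,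
          fun i hi => ⟨(hg i hi).1, (hg i hi).2, ?_⟩, rfl⟩
        -- With `τ = γⱼ γᵢ`, the path `γⱼ γᵢ` is a prefix of `γᵢ γⱼ γᵢ`; comparing lengths gives `γⱼ
        -- γᵢ = γᵢ γⱼ`.
        obtain ⟨t, ht⟩ := h i hi _ _ ((hg j hj).2.append (hg i hi).2)
        rw [← List.append_assoc (g i)] at ht
        exact (List.append_inj_left ht (by simp [add_comm])).symm
    · push Not at h
      obtain ⟨j, hj, τ, u, hτ, hpre⟩ := h
      refine .of_mul_mul (a := ghostPath K E u τ) (b := path K E τ u) ?_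
      rw [ghostPath_mul_add_mul_path hτ k S c g fun i hi => (hg i hi).2]
      refine ih _ ?_ _ (fun i => (g i ++ τ).drop τ.length) (fun i hi => ?_) rfl
      · rw [← hn]
        exact Finset.card_lt_card (Finset.filter_ssubset.2 ⟨j, hj, hpre⟩)
      · obtain ⟨hi, t, ht⟩ := Finset.mem_filter.1 hi
        have hl := congrArg List.length ht
        have hgi := List.length_pos_iff.2 (hg i hi).1
        have hpath := (hg i hi).2.append hτ
        simp only [List.length_append] at hl
        rw [← ht] at hpath ⊢
        rw [List.drop_left]
        refine ⟨List.length_pos_iff.1 (by omega), hτ.of_append hpath⟩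

/-- Nonzero linear combinations of distinct paths with the same range are reducible. -/
theorem isReducible_sum_path {v : V} {S : Finset (List A)} (hS : S.Nonempty) (c : List A → K)
    (g : List A → List A) (hc : ∀ i ∈ S, c i ≠ 0) (hinj : Set.InjOn g S)
    (hg : ∀ i ∈ S, ∃ u, E.IsPath u (g i) v) :
    IsReducible (∑ i ∈ S, c i • path K E (g i) v) := by
  classical
  -- The ghost of a shortest path turns that path into `v`, and every other path into zero or a
  -- closed path at `v`, of positive length because the paths are distinct.
  obtain ⟨j, hj, hmin⟩ := S.exists_min_image (fun i => (g i).length) hS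
  obtain ⟨u, hu⟩ := hg j hj
  refine .of_mul_left (a := ghostPath K E v (g j)) ?_
  have h : ghostPath K E v (g j) * ∑ i ∈ S, c i • path K E (g i) v =
      c j • vertex K E v + ∑ i ∈ (S.erase j).filter
        (fun i => E.IsPath u (g i) v ∧ g j <+: g i),
          c i • path K E ((g i).drop (g j).length) v := by
    rw [← Finset.add_sum_erase _ _ hj, mul_add, mul_smul_comm, ghostPath_mul_path_self K hu,
      Finset.mul_sum, Finset.sum_filter]
    congr 1
    refine Finset.sum_congr rfl fun i hi => ?_
    obtain ⟨y, hy⟩ := hg i (Finset.mem_of_mem_erase hi)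
    have hiff : u = y ↔ E.IsPath u (g i) v :=
      ⟨fun h => h ▸ hy, fun h => h.src_unique hy⟩
    rw [mul_smul_comm, ghostPath_mul_path K hu hy (hmin i (Finset.mem_of_mem_erase hi))]
    simp only [hiff]
    split_ifs
    · rfl
    · rw [smul_zero]
  rw [h]
  refine isReducible_vertex_add (hc j hj) _ _ (fun i => (g i).drop (g j).length) fun i hi => ?_
  obtain ⟨hi, hpath, t, ht⟩ := Finset.mem_filter.1 hi
  obtain ⟨hij, hi⟩ := Finset.mem_erase.1 hi
  rw [← ht] at hpath ⊢
  rw [List.drop_left]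
  refine ⟨?_, hu.of_append hpath⟩
  rintro rfl
  rw [List.append_nil] at ht
  exact hij (hinj hi hj ht.symm)

/-! ### Filtration by ghost degree and elimination of ghost edges. -/

variable (K E) in
/-- The span of the elements `μ ν^*` with `ν` of length at most `n`. -/
noncomputable def ghostDegreeLE (n : ℕ) : Submodule K (LeavittPathAlgebra K E) :=
  Submodule.span K {z | ∃ μ w ν, ν.length ≤ n ∧ z = path K E μ w * ghostPath K E w ν}

theorem path_mul_ghostPath_mem (μ : List A) (w : V) {ν : List A} {n : ℕ} (h : ν.length ≤ n) :
    path K E μ w * ghostPath K E w ν ∈ ghostDegreeLE K E n :=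
  Submodule.subset_span ⟨μ, w, ν, h, rfl⟩

theorem path_mem_ghostDegreeLE (μ : List A) (w : V) (n : ℕ) :
    path K E μ w ∈ ghostDegreeLE K E n := by
  rw [← path_mul_vertex, ← ghostPath_nil]
  exact path_mul_ghostPath_mem μ w (Nat.zero_le n)

theorem mul_mem_ghostDegreeLE {m n : ℕ} {y : LeavittPathAlgebra K E}
    (h : ∀ μ w ν, ν.length ≤ n → path K E μ w * ghostPath K E w ν * y ∈ ghostDegreeLE K E m)
    {z : LeavittPathAlgebra K E} (hz : z ∈ ghostDegreeLE K E n) :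
    z * y ∈ ghostDegreeLE K E m := by
  induction hz using Submodule.span_induction with
  | mem z hz =>
    obtain ⟨μ, w, ν, hν, rfl⟩ := hz
    exact h μ w ν hν
  | zero => rw [zero_mul]; exact zero_mem _
  | add x y _ _ hx hy => rw [add_mul]; exact add_mem hx hy
  | smul k x _ hx => rw [smul_mul_assoc]; exact Submodule.smul_mem _ _ hx

theorem mul_vertex_mem_ghostDegreeLE (v : V) {n : ℕ} {z : LeavittPathAlgebra K E}
    (hz : z ∈ ghostDegreeLE K E n) : z * vertex K E v ∈ ghostDegreeLE K E n := by
  refine mul_mem_ghostDegreeLE (fun μ w ν hν => ?_) hz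
  cases ν with
  | nil =>
    rw [ghostPath_nil, path_mul_vertex]
    by_cases h : w = v
    · subst h
      rw [path_mul_vertex]
      exact path_mem_ghostDegreeLE _ _ _
    · rw [path_mul_vertex_of_ne K E _ h]
      exact zero_mem _
  | cons e ν =>
    by_cases h : E.src e = v
    · subst h
      rw [ghostPath_cons, mul_assoc, mul_assoc, ghost_mul_vertex_src, ← ghostPath_cons]
      exact path_mul_ghostPath_mem _ _ hν
    · rw [ghostPath_cons, mul_assoc, mul_assoc, ghost_mul_vertex_of_ne K E h, mul_zero, mul_zero]
      exact zero_mem _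

theorem mul_ghost_mem_ghostDegreeLE (e : A) {n : ℕ} {z : LeavittPathAlgebra K E}
    (hz : z ∈ ghostDegreeLE K E n) : z * ghost K E e ∈ ghostDegreeLE K E (n + 1) := by
  refine mul_mem_ghostDegreeLE (fun μ w ν hν => ?_) hz
  rw [mul_assoc, ← ghostPath_cons]
  exact path_mul_ghostPath_mem _ _ (by simpa using hν)

/-- An edge cancels or kills the rightmost ghost edge; with no ghost edge present it merely
lengthens the path. The bound `n ≤ m + 1` covers both a drop in degree and `m = n = 0`. -/
theorem mul_edge_mem_ghostDegreeLE (e : A) {m n : ℕ} (hmn : n ≤ m + 1)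
    {z : LeavittPathAlgebra K E} (hz : z ∈ ghostDegreeLE K E n) :
    z * edge K E e ∈ ghostDegreeLE K E m := by
  refine mul_mem_ghostDegreeLE (fun μ w ν hν => ?_) hz
  cases ν with
  | nil =>
    rw [ghostPath_nil, path_mul_vertex]
    by_cases h : w = E.src e
    · subst h
      rw [path_mul_edge]
      exact path_mem_ghostDegreeLE _ _ _
    · rw [← path_mul_vertex, mul_assoc, vertex_mul_edge_of_ne K E h, mul_zero]
      exact zero_mem _
  | cons f ν =>
    rw [ghostPath_cons, mul_assoc, mul_assoc]
    by_cases h : f = e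
    · subst h
      rw [ghost_mul_edge_self, ← mul_assoc]
      refine mul_vertex_mem_ghostDegreeLE _ (path_mul_ghostPath_mem _ _ ?_)
      rw [List.length_cons] at hν
      omega
    · rw [ghost_mul_edge_of_ne K E h, mul_zero, mul_zero]
      exact zero_mem _

theorem ghostDegreeLE_mono : Monotone (ghostDegreeLE K E) := by
  intro m n h
  refine Submodule.span_mono ?_
  rintro z ⟨μ, w, ν, hν, rfl⟩
  exact ⟨μ, w, ν, hν.trans h, rfl⟩

/-- Quantifying over the left factor `z` lets the induction pass through products. -/
theorem exists_mul_mem_ghostDegreeLE (x : LeavittPathAlgebra K E) :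
    ∀ z n, z ∈ ghostDegreeLE K E n → ∃ m, z * x ∈ ghostDegreeLE K E m := by
  induction x using induction with
  | zero => exact fun z n _ => ⟨0, by rw [mul_zero]; exact zero_mem _⟩
  | vertex v => exact fun z n hz => ⟨n, mul_vertex_mem_ghostDegreeLE v hz⟩
  | edge e => exact fun z n hz => ⟨n, mul_edge_mem_ghostDegreeLE e n.le_succ hz⟩
  | ghost e => exact fun z n hz => ⟨n + 1, mul_ghost_mem_ghostDegreeLE e hz⟩
  | add x y hx hy =>
    intro z n hz
    obtain ⟨k, hk⟩ := hx z n hz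
    obtain ⟨m, hm⟩ := hy z n hz
    refine ⟨max k m, ?_⟩
    rw [mul_add]
    exact add_mem (ghostDegreeLE_mono (le_max_left k m) hk)
      (ghostDegreeLE_mono (le_max_right k m) hm)
  | mul x y hx hy =>
    intro z n hz
    obtain ⟨k, hk⟩ := hx z n hz
    obtain ⟨m, hm⟩ := hy _ k hk
    exact ⟨m, by rwa [← mul_assoc]⟩
  | smul k x hx =>
    intro z n hz
    obtain ⟨m, hm⟩ := hx z n hz
    exact ⟨m, by rw [mul_smul_comm]; exact Submodule.smul_mem _ _ hm⟩

theorem exists_mem_ghostDegreeLE (x : LeavittPathAlgebra K E) :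
    ∃ n, x ∈ ghostDegreeLE K E n := by
  obtain ⟨F, hF⟩ := exists_sum_vertex_mul x
  rw [← hF F subset_rfl]
  exact exists_mul_mem_ghostDegreeLE x _ 0
    (Submodule.sum_mem _ fun v _ => path_mem_ghostDegreeLE [] v 0)

theorem exists_eq_add_sum_mul_ghost {n : ℕ} {z : LeavittPathAlgebra K E}
    (hz : z ∈ ghostDegreeLE K E n) :
    ∃ y ∈ ghostDegreeLE K E 0, ∃ a : A →₀ LeavittPathAlgebra K E,
      z = y + a.sum fun e x => x * ghost K E e := by
  induction hz using Submodule.span_induction with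
  | mem z hz =>
    obtain ⟨μ, w, ν, -, rfl⟩ := hz
    cases ν with
    | nil => exact ⟨_, path_mul_ghostPath_mem μ w (ν := []) le_rfl, 0, by simp⟩
    | cons e ν =>
      refine ⟨0, zero_mem _, .single e (path K E μ w * ghostPath K E w ν), ?_⟩
      rw [Finsupp.sum_single_index (zero_mul _), zero_add, ghostPath_cons, mul_assoc]
  | zero => exact ⟨0, zero_mem _, 0, by simp⟩
  | add x y _ _ hx hy =>
    classical
    obtain ⟨x, hx, a, rfl⟩ := hx
    obtain ⟨y, hy, b, rfl⟩ := hy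
    refine ⟨x + y, add_mem hx hy, a + b, ?_⟩
    rw [Finsupp.sum_add_index' (fun _ => zero_mul _) fun _ _ _ => add_mul _ _ _,
      add_add_add_comm]
  | smul k x _ hx =>
    obtain ⟨x, hx, a, rfl⟩ := hx
    refine ⟨k • x, Submodule.smul_mem _ _ hx, k • a, ?_⟩
    rw [Finsupp.sum_smul_index' fun _ => zero_mul _, smul_add, Finsupp.smul_sum]
    simp only [smul_mul_assoc]

theorem exists_mul_vertex_eq_sum_path {z : LeavittPathAlgebra K E}
    (hz : z ∈ ghostDegreeLE K E 0) (v : V) :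
    ∃ (S : Finset (List A)) (c : List A → K),
      (∀ μ ∈ S, c μ ≠ 0) ∧ (∀ μ ∈ S, ∃ u, E.IsPath u μ v) ∧
        z * vertex K E v = ∑ μ ∈ S, c μ • path K E μ v := by
  have h : z * vertex K E v ∈
      Submodule.span K ((fun μ => path K E μ v) '' {μ | ∃ u, E.IsPath u μ v}) := by
    induction hz using Submodule.span_induction with
    | mem z hz =>
      obtain ⟨μ, w, ν, hν, rfl⟩ := hz
      rw [List.eq_nil_of_length_eq_zero (Nat.le_zero.1 hν), ghostPath_nil, path_mul_vertex]
      by_cases h : w = v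
      · subst h
        rw [path_mul_vertex]
        rcases path_eq_zero_or K μ w with h | h
        · rw [h]
          exact zero_mem _
        · exact Submodule.subset_span ⟨μ, h, rfl⟩
      · rw [path_mul_vertex_of_ne K E _ h]
        exact zero_mem _
    | zero => rw [zero_mul]; exact zero_mem _
    | add x y _ _ hx hy => rw [add_mul]; exact add_mem hx hy
    | smul k x _ hx => rw [smul_mul_assoc]; exact Submodule.smul_mem _ _ hx
  obtain ⟨l, hl, h⟩ := (Finsupp.mem_span_image_iff_linearCombination K).1 h
  exact ⟨l.support, l, fun μ hμ => Finsupp.mem_support_iff.1 hμ, fun μ hμ => hl hμ, h.symm⟩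

theorem isReducible_of_mem_ghostDegreeLE_zero {x : LeavittPathAlgebra K E} {v : V}
    (hx : x ∈ ghostDegreeLE K E 0) (h0 : x * vertex K E v ≠ 0) :
    IsReducible (x * vertex K E v) := by
  obtain ⟨S, c, hc, hS, h⟩ := exists_mul_vertex_eq_sum_path hx v
  rw [h] at h0 ⊢
  exact isReducible_sum_path (Finset.nonempty_of_sum_ne_zero h0) c id hc
    Function.injective_id.injOn hS

/-- Edges act injectively from the right on combinations of paths. -/
theorem mul_vertex_eq_zero_of_mul_edge_eq_zero {x : LeavittPathAlgebra K E}
    (hx : x ∈ ghostDegreeLE K E 0) {e : A} (h : x * edge K E e = 0) :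
    x * vertex K E (E.src e) = 0 := by
  obtain ⟨S, c, hc, hS, hsum⟩ := exists_mul_vertex_eq_sum_path hx (E.src e)
  rcases S.eq_empty_or_nonempty with rfl | hne
  · rw [hsum, Finset.sum_empty]
  -- Appending `e` keeps the paths distinct, so the product is again reducible, hence nonzero.
  · refine absurd ?_ (isReducible_sum_path hne c (· ++ [e]) hc
      (List.append_left_injective [e]).injOn
      (fun μ hμ => (hS μ hμ).imp fun u hu => hu.append (.cons e [] _ (.nil _)))).ne_zero
    rw [← vertex_src_mul_edge, ← mul_assoc, hsum, Finset.sum_mul] at h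
    simpa only [smul_mul_assoc, path_mul_edge] using h

theorem isReducible_of_mem_ghostDegreeLE (n : ℕ) : ∀ (x : LeavittPathAlgebra K E) (v : V),
    x ∈ ghostDegreeLE K E n → x * vertex K E v = x → x ≠ 0 → IsReducible x := by
  induction n with
  | zero =>
    intro x v hx hv h0
    rw [← hv] at h0 ⊢
    exact isReducible_of_mem_ghostDegreeLE_zero hx h0
  | succ n ih =>
    intro x v hx hv h0
    by_cases he : ∃ e, x * edge K E e ≠ 0
    · obtain ⟨e, he⟩ := he
      have hmem : x * edge K E e ∈ ghostDegreeLE K E n :=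
        mul_edge_mem_ghostDegreeLE e le_rfl hx
      have hrng : x * edge K E e * vertex K E (E.rng e) = x * edge K E e := by
        rw [mul_assoc, edge_mul_vertex_rng]
      exact IsReducible.of_mul_right (ih _ _ hmem hrng he)
    push Not at he
    -- Now all edges annihilate `x` from the right; the aim is that no ghost edges are left. A
    -- regular `v` is a sum of `e e^*`, which would force `x = 0`.
    obtain ⟨y, hy, a, hxy⟩ := exists_eq_add_sum_mul_ghost hx
    suffices h : x = y * vertex K E v by
      rw [h] at h0 ⊢
      exact isReducible_of_mem_ghostDegreeLE_zero hy h0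
    by_cases hreg : (E.src ⁻¹' {v}).Finite ∧ (E.src ⁻¹' {v}).Nonempty
    · refine absurd ?_ h0
      rw [← hv, vertex_eq_sum K E v hreg.1 hreg.2, Finset.mul_sum]
      refine Finset.sum_eq_zero fun e _ => ?_
      rw [← mul_assoc, he, zero_mul]
    rw [Finsupp.sum] at hxy
    have hedge : ∀ e, y * edge K E e + a e * vertex K E (E.rng e) = 0 := by
      intro e
      rw [← he e, hxy, add_mul, Finset.sum_mul, Finset.sum_eq_single e, mul_assoc,
        ghost_mul_edge_self]
      · intro f _ hf
        rw [mul_assoc, ghost_mul_edge_of_ne K E hf, mul_zero]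
      · intro ha
        rw [Finsupp.notMem_support_iff.1 ha, zero_mul, zero_mul]
    rw [← hv, hxy, add_mul, Finset.sum_mul, Finset.sum_eq_zero, add_zero]
    intro e _
    by_cases hev : E.src e = v
    · have hinf : (E.src ⁻¹' {v}).Infinite := fun h => hreg ⟨h, e, hev⟩
      -- An infinite emitter has an edge `f` not occurring in the finite sum, so `x f = 0` reads `y
      -- f = 0`. This gives `y v = 0`, and every ghost term ending in `e^*` with source `v`
      -- vanishes.
      obtain ⟨f, hfv, hf⟩ := hinf.exists_notMem_finset a.support
      have hyf := hedge f
      rw [Finsupp.notMem_support_iff.1 hf, zero_mul, add_zero] at hyf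
      have hyv := mul_vertex_eq_zero_of_mul_edge_eq_zero hy hyf
      rw [show E.src f = E.src e from hfv.trans hev.symm] at hyv
      have hye := hedge e
      rw [← vertex_src_mul_edge, ← mul_assoc, hyv, zero_mul, zero_add] at hye
      rw [← vertex_rng_mul_ghost, ← mul_assoc (a e), hye, zero_mul, zero_mul]
    · rw [mul_assoc, ghost_mul_vertex_of_ne K E hev, mul_zero]

theorem isReducible_of_ne_zero {x : LeavittPathAlgebra K E} (hx : x ≠ 0) : IsReducible x := by
  obtain ⟨v, hv⟩ := exists_mul_vertex_ne_zero hx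
  obtain ⟨n, hn⟩ := exists_mem_ghostDegreeLE (x * vertex K E v)
  exact .of_mul_right (isReducible_of_mem_ghostDegreeLE n _ v hn
    (by rw [mul_assoc, vertex_mul_self]) hv)

end Reduction

end LeavittPathAlgebra

theorem mainTheorem4 {K : Type*} [Field K] {V : Type*} {A : Type*} (E : DirGraph V A)
    (x : LeavittPathAlgebra K E) (hx : IsMinimalLeftIdeal (leftMultiples x)) :
    ∃ v : V, E.IsLinePoint v ∧
      LeftIdealIso (leftMultiples x) (leftMultiples (LeavittPathAlgebra.vertex K E v))
        (isLeftIdeal_leftMultiples x) := by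
  have h0 : x ≠ 0 := by
    rintro rfl
    refine hx.2.1 ((AddSubgroup.eq_bot_iff_forall _).2 ?_)
    rintro _ ⟨a, rfl⟩
    exact mul_zero a
  obtain ⟨a, b, ⟨v, hv⟩ | h⟩ := LeavittPathAlgebra.isReducible_of_ne_zero h0
  · have h := LeavittPathAlgebra.leftIdealIso_of_mul_mul_ne_zero hx
      (hv ▸ LeavittPathAlgebra.vertex_ne_zero K E v)
    rw [hv] at h
    exact ⟨v, LeavittPathAlgebra.isLinePoint_of_isMinimalLeftIdeal h.2, h.1⟩
  · exact absurd (LeavittPathAlgebra.leftIdealIso_of_mul_mul_ne_zero hx h.ne_zero).2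
      h.not_isMinimalLeftIdeal
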